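/- **Conventions.** Order $\mathbb Z[x]$ by $f>g$ iff $f-g$ has positive leading coefficient, and let $P[x]=\{f\in\mathbb Z[x]: f\ge 0\}$. An *affine $P[x]$-semimodule* is a set $S=\{\sum_i g_i\mathbf u_i : g_i\in P[x]\}\subseteq\mathbb Z[x]^n$ generated by finitely many $\mathbf u_1,\dots,\mathbf u_m\in\mathbb Z[x]^n$; $S^{md}=\{\mathbf u-\mathbf v:\mathbf u,\mathbf v\in S\}$ is the $\mathbb Z[x]$-module it generates and $\operatorname{rank}S=\dim_{\mathbb Q(x)}\operatorname{Span}_{\mathbb{Q}(x)}(S^{md})$. A *face* of $S$ is a $P[x]$-subsemimodule $F\subseteq S$ such that $\mathbf u,\mathbf v\in S$, $\mathbf u+\mathbf v\in F$ imply $\mathbf u,\mathbf v\in F$, and $\mathbf u\in S$, $0\ne g\in P[x]$, $g\mathbf u\in F$ imply $\mathbf u\in F$; a *facet* is a face of rank $\operatorname{rank}S-1$. $S$ is *compact* if $\bigcap_{F\text{ facet of }S}F^{md}=\{\mathbf 0\}$ (intersection inside $S^{md}$). The *standard normal vector* $\varphi_F$ of a facet $F$ is the generator of the rank one free module $\{\varphi\in\operatorname{Hom}_{\mathbb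 Z[x]}(S^{md},\mathbb Z[x]):\varphi|_F=0\}$ with $\varphi_F\ge 0$ on $S$. A *fan* $\Sigma$ is a finite set of affine $P[x]$-semimodules in $\mathbb Z[x]^n$ such that (a) $S^{md}=M$ is the same for all $S\in\Sigma$; (b) for distinct $S,T\in\Sigma$ there is $\mathbf u\in S$ with $-\mathbf u\in T$ and $S+\mathbb Z[x](-\mathbf u)=T+\mathbb Z[x]\mathbf u$; (c) for distinct $S,T,R\in\Sigma$ and $\mathbf u,\mathbf v,\mathbf w$ as in (b) for $(S,T)$, $(T,R)$, $(R,S)$, one has $S+\mathbb Z[x](-\mathbf u)+\mathbb Z[x]\mathbf w=T+\mathbb Z[x]\mathbf u+\mathbb Z[x](-\mathbf v)=R+\mathbb Z[x]\mathbf v+\mathbb Z[x](-\mathbf w)$. Let $k$ be a field of characteristic $0$ with an endomorphism $\sigma$. On $k[S]=\bigoplus_{\mathbf u\in S}k\chi^{\mathbf u}$ extend $\sigma$ by $\sigma(\chi^{\mathbf u})=\chi^{x\mathbf u}$. Let $\operatorname{Spec}^{P[\sigma]}(k[S])$ be the set of prime ideals $\mathfrak p$ of $k[S]$ with $\sigma(\mathfrak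 p)\subseteq\mathfrak p$ that are perfect (if $\prod_i\sigma^i(a)^{c_i}\in\mathfrak p$ for some $0\neq\sum_i c_ix^i\in\mathbb N[x]$, then $a\in\mathfrak p$) and satisfy $\chi^{\mathbf u}f\in\mathfrak p\Rightarrow\chi^{g\mathbf u}f\in\mathfrak p$ for all $\mathbf u\in S$ and $0\ne g\in P[x]$, with closed sets $\{\mathfrak p:E\subseteq\mathfrak p\}$, $E\subseteq k[S]$. The toric $P[\sigma]$-variety $X_\Sigma$ is obtained by gluing the spaces $\operatorname{Spec}^{P[\sigma]}(k[S])$, $S\in\Sigma$, along the open subsets $\operatorname{Spec}^{P[\sigma]}(k[S+\mathbb Z[x](-\mathbf u)])=\operatorname{Spec}^{P[\sigma]}(k[T+\mathbb Z[x]\mathbf u])$ given by (b). Consider pairs $(S,F)$ with $S\in\Sigma$ and $F$ a facet of $S$; call $(S,F)$ and $(T,G)$ equivalent if, with $\mathbf u$ as in (b), some face $H$ of $S+\mathbb Z[x](-\mathbf u)$ has $F^{md}=G^{md}=H^{md}$ (for $S=T$: if $F=G$). Each equivalence class $L$ defines a prime divisor $D_L\subseteq X_\Sigma$, glued from the closed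 subsets of $\operatorname{Spec}^{P[\sigma]}(k[S])$ defined by $\{\chi^{\mathbf u}:\mathbf u\in S\setminus F\}$, $(S,F)\in L$, and a form $\varphi_L=\varphi_F$ on $M$. Weil divisors are the elements $\sum_L a_LD_L$ of the free $\mathbb Z[x]$-module on the prime divisors; the characteristic divisors are $\operatorname{div}(\chi^{\mathbf u})=\sum_L\varphi_L(\mathbf u)D_L$, $\mathbf u\in M$. A Weil divisor $D=\sum_L a_LD_L$ is *Cartier* if $X_\Sigma$ has an open cover $\{U_i\}$ and $\mathbf u_i\in M$ with $D|_{U_i}=\operatorname{div}(\chi^{\mathbf u_i})|_{U_i}$, where $D|_U=\sum_{D_L\cap U\ne\emptyset}a_L\,(D_L\cap U)$. Finally $\operatorname{Pic}(X_\Sigma)$ is the $\mathbb Z[x]$-module of Cartier divisors modulo characteristic divisors. **Proposition.** Let $\Sigma$ be a fan. If $\Sigma$ contains a compact affine $P[x]$-semimodule, then $\operatorname{Pic}(X_\Sigma)$ is torsion-free and is a $\mathbb Z[x]$-lattice, i.e. it embeds as a $\mathbb Z[x]$-module into $\mathbb Z[x]^m$ for some $m$. -/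

import Mathlib

open Polynomial TopologicalSpace

noncomputable section

namespace PToric

/-! ### The ordered ring `ℤ[x]`, semimodules over `P[x]` and their faces -/

theorem leadingCoeff_add_nonneg {f g : ℤ[X]} (hf : 0 ≤ f.leadingCoeff)
    (hg : 0 ≤ g.leadingCoeff) : 0 ≤ (f + g).leadingCoeff := by
  rcases lt_trichotomy f.degree g.degree with h | h | h
  · rwa [leadingCoeff_add_of_degree_lt h]
  · by_cases h0 : f.leadingCoeff + g.leadingCoeff = 0
    · have hf0 : f.leadingCoeff = 0 := by linarith
      rw [leadingCoeff_eq_zero.mp hf0, zero_add]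
      exact hg
    · rw [leadingCoeff_add_of_degree_eq h h0]
      exact add_nonneg hf hg
  · rwa [leadingCoeff_add_of_degree_lt' h]

/-- `P[x]`: the semiring of all `f ≥ 0` in `ℤ[x]`, for the total order in which `f > g` iff the
leading coefficient of `f - g` is positive. -/
def P : Subsemiring ℤ[X] where
  carrier := {f | 0 ≤ f.leadingCoeff}
  mul_mem' := fun {f g} hf hg => by
    simp only [Set.mem_ofPred_eq, leadingCoeff_mul] at *
    exact mul_nonneg hf hg
  one_mem' := by simp
  add_mem' := fun hf hg => leadingCoeff_add_nonneg hf hg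
  zero_mem' := by simp

theorem mem_P {f : ℤ[X]} : f ∈ P ↔ 0 ≤ f.leadingCoeff := Iff.rfl

theorem mem_P_or_neg_mem_P (f : ℤ[X]) : f ∈ P ∨ -f ∈ P := by
  simp only [mem_P, leadingCoeff_neg]
  rcases le_total 0 f.leadingCoeff with h | h
  · exact Or.inl h
  · exact Or.inr (by linarith)

/-- The indeterminate `x` as an element of `P[x]`. -/
def xP : P := ⟨X, by simp [mem_P]⟩

/-- `P[x]`-semimodules in `ℤ[x]^n`; such a semimodule is affine when it is finitely generated,
that is, when it satisfies `Submodule.FG`. -/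
abbrev Semimod (n : ℕ) := Submodule P (Fin n → ℤ[X])

variable {n : ℕ}

/-- `S^md = {u - v | u, v ∈ S}`, the `ℤ[x]`-lattice generated by `S`. -/
def md (S : Semimod n) : Submodule ℤ[X] (Fin n → ℤ[X]) where
  carrier := {w | ∃ u ∈ S, ∃ v ∈ S, w = u - v}
  add_mem' := by
    rintro _ _ ⟨a, ha, b, hb, rfl⟩ ⟨c, hc, d, hd, rfl⟩
    exact ⟨a + c, S.add_mem ha hc, b + d, S.add_mem hb hd, by abel⟩
  zero_mem' := ⟨0, S.zero_mem, 0, S.zero_mem, by simp⟩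
  smul_mem' := by
    rintro f _ ⟨a, ha, b, hb, rfl⟩
    rcases mem_P_or_neg_mem_P f with hf | hf
    · exact ⟨f • a, S.smul_mem ⟨f, hf⟩ ha, f • b, S.smul_mem ⟨f, hf⟩ hb, smul_sub _ _ _⟩
    · refine ⟨-f • b, S.smul_mem ⟨-f, hf⟩ hb, -f • a, S.smul_mem ⟨-f, hf⟩ ha, ?_⟩
      rw [smul_sub, neg_smul, neg_smul]
      abel

theorem mem_md_of_mem {S : Semimod n} {u : Fin n → ℤ[X]} (hu : u ∈ S) : u ∈ md S :=
  ⟨u, hu, 0, S.zero_mem, by simp⟩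

theorem md_mono {S T : Semimod n} (h : S ≤ T) : md S ≤ md T := by
  rintro _ ⟨u, hu, v, hv, rfl⟩
  exact ⟨u, h hu, v, h hv, rfl⟩

/-- `F` is a face of `S`. -/
structure IsFace (S F : Semimod n) : Prop where
  le : F ≤ S
  of_add_mem : ∀ u ∈ S, ∀ v ∈ S, u + v ∈ F → u ∈ F ∧ v ∈ F
  of_smul_mem : ∀ g : P, g ≠ 0 → ∀ u ∈ S, g • u ∈ F → u ∈ F

/-- `F` is a facet of `S`: a face of rank `rank S - 1`. -/
structure IsFacet (S F : Semimod n) : Prop where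
  isFace : IsFace S F
  rank_add_one : Module.finrank ℤ[X] (md F) + 1 = Module.finrank ℤ[X] (md S)

/-- `S` is compact: the lattices `F^md`, where `F` runs over the facets of `S`, intersect in `0`.
The intersection is taken inside `S^md`. -/
def IsCompactSemimod (S : Semimod n) : Prop :=
  md S ⊓ ⨅ F ∈ {F : Semimod n | IsFacet S F}, md F = ⊥

/-- An affine semimodule has only finitely many faces. -/
theorem finite_setOf_isFace {S : Semimod n} (hS : S.FG) : {F | IsFace S F}.Finite := by
  obtain ⟨U, rfl⟩ := hS
  have key : ∀ F, IsFace (Submodule.span P (U : Set (Fin n → ℤ[X]))) F →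
      F = Submodule.span P ((U : Set (Fin n → ℤ[X])) ∩ F) := by
    intro F hF
    apply le_antisymm
    · intro w hw
      have hw' := hF.le hw
      revert hw
      induction hw' using Submodule.span_induction with
      | mem u hu => exact fun h => Submodule.subset_span ⟨hu, h⟩
      | zero => exact fun _ => Submodule.zero_mem _
      | add u v hu hv ihu ihv =>
        intro h
        obtain ⟨h1, h2⟩ := hF.of_add_mem u hu v hv h
        exact Submodule.add_mem _ (ihu h1) (ihv h2)
      | smul g u hu ih =>
        intro h
        by_cases hg : g = 0
        · rw [hg, zero_smul]; exact Submodule.zero_mem _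
        · exact Submodule.smul_mem _ _ (ih (hF.of_smul_mem g hg u hu h))
    · exact Submodule.span_le.mpr fun u hu => hu.2
  refine Set.Finite.subset
    ((U.finite_toSet.finite_subsets).image fun V => Submodule.span P V) ?_
  intro F hF
  exact ⟨(U : Set (Fin n → ℤ[X])) ∩ F, Set.inter_subset_left, (key F hF).symm⟩

/-! ### Standard normal vectors -/

/-- `V(F) = {φ ∈ Hom(S^md, ℤ[x]) | F = H_φ ∩ S}`, where `H_φ` is the kernel of `φ`. -/
def normalVectors (S F : Semimod n) : Set (Module.Dual ℤ[X] (md S)) :=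
  {φ | ∀ u : md S, (u : Fin n → ℤ[X]) ∈ F ↔ φ u = 0 ∧ (u : Fin n → ℤ[X]) ∈ S}

/-- `φ` is a standard normal vector of the facet `F` of `S`: it is a basis of the rank one module
formed by `V(F)` and `0`, and `S` lies in the closed half-space `{u | φ u ≥ 0}`. -/
structure IsStandardNormal (S F : Semimod n) (φ : Module.Dual ℤ[X] (md S)) : Prop where
  mem : φ ∈ normalVectors S F
  span_eq : (Submodule.span ℤ[X] {φ} : Set (Module.Dual ℤ[X] (md S))) =
    insert 0 (normalVectors S F)
  nonneg : ∀ u : md S, (u : Fin n → ℤ[X]) ∈ S → φ u ∈ P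

theorem IsFace.mem_of_smul_mem_md {S F : Semimod n} (hF : IsFace S F) {u : Fin n → ℤ[X]}
    (hu : u ∈ S) {a : ℤ[X]} (ha : a ≠ 0) (h : a • u ∈ md F) : u ∈ F := by
  have key : ∀ b : ℤ[X], b ≠ 0 → b ∈ P → b • u ∈ md F → u ∈ F := by
    rintro b hb0 hb ⟨f, hf, f', hf', h⟩
    have hbu : b • u ∈ S := S.smul_mem ⟨b, hb⟩ hu
    refine hF.of_smul_mem ⟨b, hb⟩ (fun h0 => hb0 (congrArg Subtype.val h0)) u hu ?_
    exact (hF.of_add_mem _ hbu _ (hF.le hf') (by rw [h, sub_add_cancel]; exact hf)).1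
  rcases mem_P_or_neg_mem_P a with hP | hP
  · exact key a ha hP h
  · exact key (-a) (neg_ne_zero.mpr ha) hP (by rw [neg_smul]; exact (md F).neg_mem h)

section Dual

variable {M : Type} [AddCommGroup M] [Module ℤ[X] M] [Module.Finite ℤ[X] M]

theorem exists_smul_mem_of_finrank {N : Submodule ℤ[X] M}
    (hN : Module.finrank ℤ[X] N + 1 = Module.finrank ℤ[X] M) {ψ : Module.Dual ℤ[X] M}
    (h0 : ψ ≠ 0) (hψ : ∀ v ∈ N, ψ v = 0) {u : M} (hu : ψ u = 0) :
    ∃ a : ℤ[X], a ≠ 0 ∧ a • u ∈ N := by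
  have hle : N ≤ LinearMap.ker ψ := fun v hv => hψ v hv
  have h1 := (LinearMap.ker ψ).finrank_quotient_add_finrank
  rw [ψ.quotKerEquivRange.finrank_eq] at h1
  have h2 : 0 < Module.finrank ℤ[X] (LinearMap.range ψ) := by
    rw [Nat.pos_iff_ne_zero]
    intro h
    rw [Module.finrank_eq_zero_iff] at h
    obtain ⟨v, hv⟩ : ∃ v, ψ v ≠ 0 := by
      by_contra! hc
      exact h0 (LinearMap.ext hc)
    obtain ⟨a, ha, hav⟩ := h ⟨ψ v, v, rfl⟩
    have : a * ψ v = 0 := congrArg Subtype.val hav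
    exact (mul_ne_zero ha hv) this
  have h3 := (N.comap (LinearMap.ker ψ).subtype).finrank_quotient_add_finrank
  rw [(Submodule.comapSubtypeEquivOfLe hle).finrank_eq] at h3
  have h4 : Module.finrank ℤ[X] (LinearMap.ker ψ ⧸ N.comap (LinearMap.ker ψ).subtype) = 0 := by
    omega
  rw [Module.finrank_eq_zero_iff] at h4
  obtain ⟨a, ha, hau⟩ := h4 (Submodule.Quotient.mk ⟨u, hu⟩)
  refine ⟨a, ha, ?_⟩
  rw [← Submodule.Quotient.mk_smul, Submodule.Quotient.mk_eq_zero] at hau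
  exact hau

theorem exists_generator {N : Submodule ℤ[X] M}
    (hN : Module.finrank ℤ[X] N + 1 = Module.finrank ℤ[X] M) {φ₀ : Module.Dual ℤ[X] M}
    (h0 : φ₀ ≠ 0) (hφ₀ : ∀ v ∈ N, φ₀ v = 0) :
    ∃ φ : Module.Dual ℤ[X] M, φ ≠ 0 ∧ (∀ v ∈ N, φ v = 0) ∧
      ∀ ψ : Module.Dual ℤ[X] M, (∀ v ∈ N, ψ v = 0) → ∃ a : ℤ[X], ψ = a • φ := by
  classical
  let _ : NormalizedGCDMonoid ℤ[X] := Classical.choice inferInstance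
  obtain ⟨u₀, hu₀⟩ : ∃ v, φ₀ v ≠ 0 := by
    by_contra! hc
    exact h0 (LinearMap.ext hc)
  obtain ⟨s, hs⟩ := (Module.Finite.fg_top : (⊤ : Submodule ℤ[X] M).FG)
  set d := s.gcd φ₀ with hd
  have hdvd : ∀ u, ∃ c, φ₀ u = d * c := by
    intro u
    have hu : u ∈ Submodule.span ℤ[X] (s : Set M) := hs ▸ Submodule.mem_top
    change d ∣ φ₀ u
    induction hu using Submodule.span_induction with
    | mem u hu => exact Finset.gcd_dvd hu
    | zero => simp
    | add u v _ _ h1 h2 => rw [map_add]; exact dvd_add h1 h2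
    | smul a u _ h => rw [map_smul]; exact h.mul_left a
  have hd0 : d ≠ 0 := by
    intro h
    obtain ⟨c, hc⟩ := hdvd u₀
    rw [h, zero_mul] at hc
    exact hu₀ hc
  choose q hq using hdvd
  let φ : Module.Dual ℤ[X] M :=
    { toFun := q
      map_add' := fun u v => mul_left_cancel₀ hd0 (by rw [mul_add, ← hq, ← hq, ← hq, map_add])
      map_smul' := fun a u => mul_left_cancel₀ hd0 (by
        rw [← hq, map_smul, hq u, smul_eq_mul, smul_eq_mul, RingHom.id_apply]; ring) }
  have hφ : ∀ u, φ₀ u = d * φ u := hq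
  have hφN : ∀ v ∈ N, φ v = 0 := fun v hv =>
    (mul_eq_zero.mp ((hφ v).symm.trans (hφ₀ v hv))).resolve_left hd0
  refine ⟨φ, ?_, hφN, fun ψ hψ => ?_⟩
  · intro h
    apply hu₀
    rw [hφ, h, LinearMap.zero_apply, mul_zero]
  have hprop : ∀ u, ψ u₀ * φ₀ u = φ₀ u₀ * ψ u := by
    intro u
    by_contra hne
    have hne' : ψ u₀ • φ₀ - φ₀ u₀ • ψ ≠ 0 := by
      intro h
      apply hne
      have := LinearMap.congr_fun h u
      simpa [sub_eq_zero] using this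
    obtain ⟨a, ha, hau⟩ := exists_smul_mem_of_finrank (u := u₀) hN hne'
      (fun v hv => by simp [hψ v hv, hφ₀ v hv]) (by simp [mul_comm])
    have := hφ₀ _ hau
    rw [map_smul, smul_eq_mul] at this
    exact (mul_ne_zero ha hu₀) this
  have hdiv : φ₀ u₀ ∣ ψ u₀ * d := by
    have h1 : φ₀ u₀ ∣ s.gcd fun u => ψ u₀ * φ₀ u :=
      Finset.dvd_gcd fun u _ => ⟨ψ u, hprop u⟩
    exact h1.trans (Finset.gcd_mul_left' s φ₀ (ψ u₀)).dvd
  obtain ⟨c, hc⟩ := hdiv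
  have hφu₀ : φ u₀ ≠ 0 := fun h => hu₀ (by rw [hφ, h, mul_zero])
  have hc' : ψ u₀ = c * φ u₀ := by
    apply mul_right_cancel₀ hd0
    rw [hc, hφ]; ring
  refine ⟨c, LinearMap.ext fun u => ?_⟩
  have h1 := hprop u
  rw [hφ, hφ, hc'] at h1
  have h2 : (d * φ u₀) * ψ u = (d * φ u₀) * (c * φ u) := by rw [← h1]; ring
  simpa using mul_left_cancel₀ (mul_ne_zero hd0 hφu₀) h2

end Dual

theorem exists_dual_ne_zero {M N : Submodule ℤ[X] (Fin n → ℤ[X])}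
    {u₀ : Fin n → ℤ[X]} (hu₀M : u₀ ∈ M) (hu₀ : ∀ a : ℤ[X], a ≠ 0 → a • u₀ ∉ N) :
    ∃ φ : Module.Dual ℤ[X] M, φ ≠ 0 ∧ ∀ v : M, (v : Fin n → ℤ[X]) ∈ N → φ v = 0 := by
  let K := FractionRing ℤ[X]
  let j : (Fin n → ℤ[X]) → (Fin n → K) := fun u i => algebraMap ℤ[X] K (u i)
  have hj : ∀ (a : ℤ[X]) u, j (a • u) = algebraMap ℤ[X] K a • j u := by
    intro a u; ext i; simp [j]
  have hspan : ∀ w ∈ Submodule.span K (j '' N), ∃ a : ℤ[X], a ≠ 0 ∧ ∃ v ∈ N,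
      algebraMap ℤ[X] K a • w = j v := by
    intro w hw
    induction hw using Submodule.span_induction with
    | mem w hw =>
      obtain ⟨v, hv, rfl⟩ := hw
      exact ⟨1, one_ne_zero, v, hv, by simp⟩
    | zero => exact ⟨1, one_ne_zero, 0, N.zero_mem, by ext i; simp [j]⟩
    | add w w' _ _ h h' =>
      obtain ⟨a, ha, v, hv, e⟩ := h
      obtain ⟨a', ha', v', hv', e'⟩ := h'
      refine ⟨a * a', mul_ne_zero ha ha', a' • v + a • v',
        N.add_mem (N.smul_mem _ hv) (N.smul_mem _ hv'), ?_⟩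
      have : j (a' • v + a • v') = j (a' • v) + j (a • v') := by ext i; simp [j]
      rw [this, hj, hj, ← e, ← e', smul_smul, smul_smul, smul_add, ← map_mul, ← map_mul,
        mul_comm a' a]
    | smul c w _ h =>
      obtain ⟨a, ha, v, hv, e⟩ := h
      obtain ⟨p, q, hq, rfl⟩ := IsFractionRing.div_surjective (A := ℤ[X]) c
      have hq0 : q ≠ 0 := nonZeroDivisors.ne_zero hq
      refine ⟨q * a, mul_ne_zero hq0 ha, p • v, N.smul_mem _ hv, ?_⟩
      have hqK : algebraMap ℤ[X] K q ≠ 0 := by simpa using hq0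
      rw [hj, ← e, smul_smul, smul_smul, map_mul]
      congr 1
      rw [mul_right_comm, mul_div_cancel₀ _ hqK]
  have hnot : j u₀ ∉ Submodule.span K (j '' N) := by
    intro h
    obtain ⟨a, ha, v, hv, e⟩ := hspan _ h
    rw [← hj] at e
    have : a • u₀ = v := by
      ext1 i
      exact IsFractionRing.injective ℤ[X] K (congrFun e i)
    exact hu₀ a ha (this ▸ hv)
  obtain ⟨f, hf, hfker⟩ := Submodule.exists_le_ker_of_notMem hnot
  obtain ⟨b, hb⟩ := IsLocalization.exist_integer_multiples_of_finite (nonZeroDivisors ℤ[X])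
    (fun i : Fin n => f (Pi.single i 1))
  choose c hc using hb
  have hval : ∀ u : Fin n → ℤ[X],
      algebraMap ℤ[X] K (∑ i, u i * c i) = algebraMap ℤ[X] K b * f (j u) := by
    intro u
    have : f (j u) = ∑ i, j u i * f (Pi.single i 1) := by
      conv_lhs => rw [pi_eq_sum_univ' (j u)]
      simp [map_sum]
    rw [this, Finset.mul_sum, map_sum]
    refine Finset.sum_congr rfl fun i _ => ?_
    rw [map_mul, hc, Algebra.smul_def]
    simp only [j]
    ring
  have hb0 : algebraMap ℤ[X] K b ≠ 0 := by
    simp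
  let φ : Module.Dual ℤ[X] M :=
    (∑ i, (c i) • (LinearMap.proj i : (Fin n → ℤ[X]) →ₗ[ℤ[X]] ℤ[X])).comp M.subtype
  have hφ : ∀ u : M, φ u = ∑ i, (u : Fin n → ℤ[X]) i * c i := by
    intro u; simp [φ, mul_comm]
  refine ⟨φ, ?_, ?_⟩
  · intro h
    have h1 : φ ⟨u₀, hu₀M⟩ = 0 := by rw [h]; rfl
    rw [hφ] at h1
    have h2 := hval u₀
    rw [h1, map_zero] at h2
    exact mul_ne_zero hb0 hf h2.symm
  · intro v hv
    apply IsFractionRing.injective ℤ[X] K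
    rw [hφ, hval, map_zero]
    have : f (j v) = 0 := hfker (Submodule.subset_span ⟨v, hv, rfl⟩)
    rw [this, mul_zero]

/-- Every facet has exactly one standard normal vector. -/
theorem existsUnique_isStandardNormal {S F : Semimod n} (hF : IsFacet S F) :
    ∃! φ, IsStandardNormal S F φ := by
  set N : Submodule ℤ[X] (md S) := (md F).comap (md S).subtype with hNdef
  have hN : Module.finrank ℤ[X] N + 1 = Module.finrank ℤ[X] (md S) := by
    rw [(Submodule.comapSubtypeEquivOfLe (md_mono hF.isFace.le)).finrank_eq]
    exact hF.rank_add_one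
  have hFN : ∀ v : md S, (v : Fin n → ℤ[X]) ∈ F → v ∈ N := fun v hv => mem_md_of_mem hv
  have hkill : ∀ ψ : Module.Dual ℤ[X] (md S),
      (∀ v : md S, (v : Fin n → ℤ[X]) ∈ F → ψ v = 0) → ∀ v ∈ N, ψ v = 0 := by
    rintro ψ h ⟨_, hv'⟩ ⟨a, ha, b, hb, rfl⟩
    have h1 := h ⟨a, mem_md_of_mem (hF.isFace.le ha)⟩ ha
    have h2 := h ⟨b, mem_md_of_mem (hF.isFace.le hb)⟩ hb
    have : (⟨a - b, hv'⟩ : md S) = ⟨a, mem_md_of_mem (hF.isFace.le ha)⟩ -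
      ⟨b, mem_md_of_mem (hF.isFace.le hb)⟩ := rfl
    rw [this, map_sub, h1, h2, sub_zero]
  have hmem : ∀ ψ : Module.Dual ℤ[X] (md S), ψ ≠ 0 → (∀ v ∈ N, ψ v = 0) →
      ψ ∈ normalVectors S F := by
    intro ψ h0 hψ u
    refine ⟨fun hu => ⟨hψ u (hFN u hu), hF.isFace.le hu⟩, fun ⟨hu, huS⟩ => ?_⟩
    obtain ⟨a, ha, hau⟩ := exists_smul_mem_of_finrank hN h0 hψ hu
    exact hF.isFace.mem_of_smul_mem_md huS ha hau
  have hne : ∀ ψ ∈ normalVectors S F, ψ ≠ 0 := by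
    rintro ψ hψ rfl
    have hSF : S ≤ F := fun u hu => (hψ ⟨u, mem_md_of_mem hu⟩).mpr ⟨rfl, hu⟩
    have := hF.rank_add_one
    rw [le_antisymm hSF hF.isFace.le] at this
    omega
  have hnonzero : ∀ ψ : Module.Dual ℤ[X] (md S), ψ ≠ 0 →
      ∃ u : md S, (u : Fin n → ℤ[X]) ∈ S ∧ ψ u ≠ 0 := by
    intro ψ h0
    by_contra! hc
    apply h0
    ext1 ⟨_, hv'⟩
    obtain ⟨a, ha, b, hb, rfl⟩ := id hv'
    have : (⟨a - b, hv'⟩ : md S) = ⟨a, mem_md_of_mem ha⟩ - ⟨b, mem_md_of_mem hb⟩ := rfl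
    rw [this, map_sub, hc _ ha, hc _ hb]
    simp
  obtain ⟨w, hw⟩ : ∃ w : md S, ∀ a : ℤ[X], a ≠ 0 → a • w ∉ N := by
    obtain ⟨w, hw⟩ := N.exists_of_finrank_lt (by omega)
    exact ⟨w, hw⟩
  obtain ⟨φ₀, hφ₀, hφ₀N⟩ := exists_dual_ne_zero (N := md F) w.2 fun a ha h => hw a ha h
  obtain ⟨φ, hφ, hφN, hgen⟩ := exists_generator hN hφ₀ fun v hv => hφ₀N v hv
  have hopp : ∀ u v : md S, (u : Fin n → ℤ[X]) ∈ S → (v : Fin n → ℤ[X]) ∈ S →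
      φ u ∈ P → -φ v ∈ P → φ u = 0 ∨ φ v = 0 := by
    intro u v hu hv hPu hPv
    by_contra! hc
    have h1 : (φ u • v + (-φ v) • u : md S).1 ∈ S :=
      S.add_mem (S.smul_mem ⟨_, hPu⟩ hv) (S.smul_mem ⟨_, hPv⟩ hu)
    have h2 : φ (φ u • v + (-φ v) • u) = 0 := by
      rw [map_add, map_smul, map_smul, smul_eq_mul, smul_eq_mul]; ring
    have h3 := (hmem φ hφ hφN _).mpr ⟨h2, h1⟩
    have h4 := (hF.isFace.of_add_mem _ (S.smul_mem ⟨_, hPu⟩ hv) _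
      (S.smul_mem ⟨_, hPv⟩ hu) h3).1
    have h5 := hF.isFace.of_smul_mem ⟨_, hPu⟩ (fun h => hc.1 (congrArg Subtype.val h)) _ hv h4
    exact hc.2 ((hmem φ hφ hφN v).mp h5).1
  have hsign : ∃ φ' : Module.Dual ℤ[X] (md S), (φ' = φ ∨ φ' = -φ) ∧
      ∀ u : md S, (u : Fin n → ℤ[X]) ∈ S → φ' u ∈ P := by
    by_cases h : ∀ u : md S, (u : Fin n → ℤ[X]) ∈ S → φ u ∈ P
    · exact ⟨φ, Or.inl rfl, h⟩
    · push Not at h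
      obtain ⟨v, hv, hvP⟩ := h
      refine ⟨-φ, Or.inr rfl, fun u hu => ?_⟩
      rw [LinearMap.neg_apply]
      rcases mem_P_or_neg_mem_P (φ u) with h' | h'
      · rcases hopp u v hu hv h' ((mem_P_or_neg_mem_P _).resolve_left hvP) with h0 | h0
        · rw [h0, neg_zero]; exact P.zero_mem
        · exact absurd (h0 ▸ P.zero_mem) hvP
      · exact h'
  obtain ⟨φ', hφ', hnonneg⟩ := hsign
  have hφ'0 : φ' ≠ 0 := by rcases hφ' with rfl | rfl; exacts [hφ, neg_ne_zero.mpr hφ]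
  have hφ'N : ∀ v ∈ N, φ' v = 0 := by
    rcases hφ' with rfl | rfl
    · exact hφN
    · exact fun v hv => by rw [LinearMap.neg_apply, hφN v hv, neg_zero]
  have hgen' : ∀ ψ : Module.Dual ℤ[X] (md S), (∀ v ∈ N, ψ v = 0) → ∃ a : ℤ[X], a • φ' = ψ := by
    intro ψ hψ
    obtain ⟨a, rfl⟩ := hgen ψ hψ
    rcases hφ' with rfl | rfl
    · exact ⟨a, rfl⟩
    · exact ⟨-a, by simp⟩
  refine ⟨φ', ⟨hmem φ' hφ'0 hφ'N, ?_, hnonneg⟩, ?_⟩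
  · ext ψ
    rw [SetLike.mem_coe, Submodule.mem_span_singleton, Set.mem_insert_iff]
    constructor
    · rintro ⟨a, rfl⟩
      by_cases h0 : a • φ' = 0
      · exact Or.inl h0
      · exact Or.inr (hmem _ h0 fun v hv => by rw [LinearMap.smul_apply, hφ'N v hv, smul_zero])
    · rintro (rfl | h)
      · exact ⟨0, zero_smul _ _⟩
      · exact hgen' ψ (hkill ψ fun v hv => ((h v).mp hv).1)
  · intro ψ hψ
    obtain ⟨a, ha⟩ := hgen' ψ (hkill ψ fun v hv => ((hψ.mem v).mp hv).1)
    have : φ' ∈ (Submodule.span ℤ[X] {ψ} : Set (Module.Dual ℤ[X] (md S))) := by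
      rw [hψ.span_eq]; exact Or.inr (hmem φ' hφ'0 hφ'N)
    obtain ⟨b, hb⟩ := Submodule.mem_span_singleton.mp this
    obtain ⟨u, hu, hu0⟩ := hnonzero φ' hφ'0
    have h1 : a * φ' u = ψ u := by rw [← ha]; rfl
    have h2 : b * (a * φ' u) = φ' u := by
      rw [h1]; conv_rhs => rw [← hb]
      rfl
    have hba : b * a = 1 := mul_right_cancel₀ hu0 (by rw [mul_assoc, h2, one_mul])
    obtain ⟨e, he, hea⟩ := Polynomial.isUnit_iff.mp (IsUnit.of_mul_eq_one_right b hba)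
    have h3 : 0 ≤ (ψ u).leadingCoeff := hψ.nonneg u hu
    have h4 : 0 ≤ (φ' u).leadingCoeff := hnonneg u hu
    have h5 : 0 ≤ (a * φ' u).leadingCoeff := by rw [h1]; exact h3
    have h6 : 0 < (φ' u).leadingCoeff := lt_of_le_of_ne h4 fun h => hu0 (leadingCoeff_eq_zero.mp h.symm)
    rw [leadingCoeff_mul, ← hea, leadingCoeff_C] at h5
    have he1 : e = 1 := by
      rcases Int.isUnit_iff.mp he with h | h
      · exact h
      · rw [h] at h5; linarith
    rw [← ha, ← hea, he1, C_1, one_smul]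

/-- The standard normal vector `φ_F` of a facet `F` of `S`. -/
def standardNormal {S F : Semimod n} (hF : IsFacet S F) :
    Module.Dual ℤ[X] (md S) :=
  (existsUnique_isStandardNormal hF).choose

/-! ### Semimodule algebras and their spectra -/

/-- The algebra `k[S]` with basis `χ^u`, `u ∈ S`. -/
abbrev Alg (k : Type*) [Field k] (S : Semimod n) := AddMonoidAlgebra k S

section Spectrum

variable {k : Type*} [Field k]

/-- The basis element `χ^u` of `k[S]`. -/
def chi (k : Type*) [Field k] {S : Semimod n} (u : S) : Alg k S := AddMonoidAlgebra.single u 1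

/-- The endomorphism `σ` of `k[S]` which extends `σ` on `k` and maps `χ^u` to `χ^(x u)`. -/
def shift (σ : k →+* k) (S : Semimod n) : Alg k S →+* Alg k S :=
  (AddMonoidAlgebra.mapDomainRingHom k (DistribSMul.toAddMonoidHom S xP)).comp
    (AddMonoidAlgebra.mapRingHom S σ)

theorem shift_single (σ : k →+* k) (S : Semimod n) (u : S) (c : k) :
    shift σ S (AddMonoidAlgebra.single u c) = AddMonoidAlgebra.single (xP • u) (σ c) := by
  simp [shift]

/-- The inclusion `k[S] → k[T]` for `S ⊆ T`. -/
def incl (k : Type*) [Field k] {S T : Semimod n} (h : S ≤ T) : Alg k S →+* Alg k T :=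
  AddMonoidAlgebra.mapDomainRingHom k (Submodule.inclusion h).toAddMonoidHom

/-- The power `a^g = ∏ σ^i(a)^(c_i)` for `g = ∑ c_i x^i` in `ℕ[x]`. -/
def spow {R : Type*} [CommRing R] (τ : R →+* R) (a : R) (g : ℕ[X]) : R :=
  ∏ i ∈ g.support, (τ^[i] a) ^ g.coeff i

/-- A `P[σ]`-prime ideal of `k[S]`: a prime ideal that is stable under `σ`, is perfect, and
contains `χ^(g u) f` for all `g ∈ P[x]`, `g ≠ 0`, whenever it contains `χ^u f`. Since the
`P[σ]`-monomials of `k[S]` are the elements `χ^u`, these are the ideals whose preimages under a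
presentation of `k[S]` as a quotient of a `P[σ]`-polynomial ring are `P[σ]`-prime. -/
structure IsPPrime (σ : k →+* k) {S : Semimod n} (I : Ideal (Alg k S)) : Prop where
  isPrime : I.IsPrime
  shift_mem : ∀ f ∈ I, shift σ S f ∈ I
  perfect : ∀ (f : Alg k S) (g : ℕ[X]), g ≠ 0 → spow (shift σ S) f g ∈ I → f ∈ I
  chi_smul_mul_mem : ∀ (u : S) (f : Alg k S) (g : P), g ≠ 0 →
    chi k u * f ∈ I → chi k (g • u) * f ∈ I

/-- `Spec^{P[σ]}(k[S])`, the set of `P[σ]`-prime ideals of `k[S]`. -/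
def PSpec (σ : k →+* k) (S : Semimod n) := {I : Ideal (Alg k S) // IsPPrime σ I}

/-- The closed set `{𝔭 | E ⊆ 𝔭}` defined by a subset `E` of `k[S]`. -/
def zeroLocus (σ : k →+* k) (S : Semimod n) (E : Set (Alg k S)) : Set (PSpec σ S) :=
  {p | E ⊆ p.1}

instance (σ : k →+* k) (S : Semimod n) : TopologicalSpace (PSpec σ S) :=
  TopologicalSpace.ofClosed {Z | ∃ E, Z = zeroLocus σ S E}
    ⟨Set.univ, by
      ext p
      simp only [Set.mem_empty_iff_false, zeroLocus, Set.mem_ofPred_eq, false_iff]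
      exact fun h => p.2.isPrime.ne_top ((Ideal.eq_top_iff_one _).mpr (h (Set.mem_univ 1)))⟩
    (by
      intro A hA
      have hA' : ∀ Z ∈ A, ∃ E, Z = zeroLocus σ S E := fun Z hZ => hA hZ
      choose! E hE using hA'
      refine ⟨⋃ Z ∈ A, E Z, ?_⟩
      ext p
      simp only [Set.mem_sInter, zeroLocus, Set.mem_ofPred_eq, Set.iUnion_subset_iff]
      refine forall₂_congr fun Z hZ => ?_
      conv_lhs => rw [hE Z hZ]
      rfl)
    (by
      rintro _ ⟨E₁, rfl⟩ _ ⟨E₂, rfl⟩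
      refine ⟨{h | ∃ f ∈ E₁, ∃ g ∈ E₂, h = f * g}, ?_⟩
      ext p
      simp only [Set.mem_union, zeroLocus, Set.mem_ofPred_eq]
      constructor
      · rintro (h | h) _ ⟨f, hf, g, hg, rfl⟩
        · exact p.1.mul_mem_right _ (h hf)
        · exact p.1.mul_mem_left _ (h hg)
      · intro h
        by_contra! hc
        obtain ⟨f, hf, hfp⟩ := Set.not_subset.mp hc.1
        obtain ⟨g, hg, hgp⟩ := Set.not_subset.mp hc.2
        exact (p.2.isPrime.mem_or_mem (h ⟨f, hf, g, hg, rfl⟩)).elim hfp hgp)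

theorem isClosed_iff {σ : k →+* k} {S : Semimod n} {Z : Set (PSpec σ S)} :
    IsClosed Z ↔ ∃ E, Z = zeroLocus σ S E :=
  by rw [← isOpen_compl_iff]; change (Zᶜᶜ ∈ _) ↔ _; rw [compl_compl]; rfl

/-- The subvariety `D(F)` of `Spec^{P[σ]}(k[S])`: the zero set of `k[S \ F]`. -/
def faceLocus (σ : k →+* k) (S F : Semimod n) : Set (PSpec σ S) :=
  zeroLocus σ S {f | ∃ u : S, (u : Fin n → ℤ[X]) ∉ F ∧ f = chi k u}

end Spectrum

/-! ### Fans -/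

/-- The semimodule `S + ℤ[x]u`. -/
def adjoin (S : Semimod n) (u : Fin n → ℤ[X]) : Semimod n :=
  S ⊔ (Submodule.span ℤ[X] {u}).restrictScalars P

theorem le_adjoin (S : Semimod n) (u : Fin n → ℤ[X]) : S ≤ adjoin S u := le_sup_left

/-- `u ∈ S`, `-u ∈ T` and `S + ℤ[x](-u) = T + ℤ[x]u`. -/
structure IsGluing (S T : Semimod n) (u : Fin n → ℤ[X]) : Prop where
  mem : u ∈ S
  neg_mem : -u ∈ T
  adjoin_eq : adjoin S (-u) = adjoin T u

theorem IsGluing.le_adjoin {S T : Semimod n} {u : Fin n → ℤ[X]} (h : IsGluing S T u) :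
    T ≤ adjoin S (-u) :=
  h.adjoin_eq ▸ PToric.le_adjoin T u

end PToric

open PToric in
/-- A fan in `ℤ[x]^n`: a finite compatible collection of affine `P[x]`-semimodules. -/
structure PFan (n : ℕ) where
  cones : Finset (Semimod n)
  fg : ∀ S ∈ cones, S.FG
  /-- The lattice `Σ^md`. -/
  lattice : Submodule ℤ[X] (Fin n → ℤ[X])
  md_eq : ∀ S ∈ cones, md S = lattice
  exists_gluing : ∀ S ∈ cones, ∀ T ∈ cones, S ≠ T → ∃ u, IsGluing S T u
  cocycle : ∀ S ∈ cones, ∀ T ∈ cones, ∀ R ∈ cones, S ≠ T → T ≠ R → R ≠ S →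
    ∀ u v w, IsGluing S T u → IsGluing T R v → IsGluing R S w →
      adjoin (adjoin S (-u)) w = adjoin (adjoin T u) (-v) ∧
      adjoin (adjoin T u) (-v) = adjoin (adjoin R v) (-w)

namespace PFan

open PToric

variable {n : ℕ}

/-! ### Prime divisors, as classes of facets -/

/-- The facets of the semimodules in `Σ`, each remembered together with the semimodule. -/
abbrev Facet (Δ : PFan n) := Σ S : {S // S ∈ Δ.cones}, {F : Semimod n // IsFacet S.1 F}

instance (Δ : PFan n) : Finite Δ.Facet := by
  have : ∀ S : {S // S ∈ Δ.cones}, Finite {F : Semimod n // IsFacet S.1 F} := fun S =>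
    ((finite_setOf_isFace (Δ.fg S.1 S.2)).subset fun _ h => h.isFace).to_subtype
  infer_instance

/-- Facets `F ≼ S` and `G ≼ T` are equivalent if, with `u` as in the definition of a fan, there is
a face `H` of `S + ℤ[x](-u) = T + ℤ[x]u` such that `F^md = G^md = H^md`. For `S = T` this just
says that `F = G`. -/
def FacetEquiv (Δ : PFan n) (A B : Δ.Facet) : Prop :=
  ∃ u, IsGluing A.1.1 B.1.1 u ∧ ∃ H, IsFace (adjoin A.1.1 (-u)) H ∧
    md A.2.1 = md H ∧ md B.2.1 = md H

/-- `L_Σ(1)`: the equivalence classes of facets. They index the prime divisors. -/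
def PrimeDivisor (Δ : PFan n) := Quot Δ.FacetEquiv

instance (Δ : PFan n) : Finite Δ.PrimeDivisor :=
  Finite.of_surjective _ Quot.mk_surjective

/-- The standard normal vector of a facet, as a linear form on `Σ^md`. -/
def facetNormal (Δ : PFan n) (A : Δ.Facet) : Module.Dual ℤ[X] Δ.lattice :=
  (standardNormal A.2.2).comp
    (Submodule.inclusion (Δ.md_eq _ A.1.2).ge)

/-- `φ_L`: the standard normal vector of a representative of `L`. -/
def normal (Δ : PFan n) (L : Δ.PrimeDivisor) : Module.Dual ℤ[X] Δ.lattice :=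
  Δ.facetNormal (Quot.out L)

/-! ### The toric `P[σ]`-variety of a fan -/

section Variety

variable {k : Type*} [Field k]

/-- The disjoint union of the affine toric varieties `Spec^{P[σ]}(k[S])`, `S ∈ Σ`. -/
abbrev Charts (σ : k →+* k) (Δ : PFan n) := Σ S : {S // S ∈ Δ.cones}, PSpec σ S.1

/-- Points of the charts of `S` and `T` are glued if they come from a common point of
`Spec^{P[σ]}(k[S + ℤ[x](-u)]) = Spec^{P[σ]}(k[T + ℤ[x]u])`, the open subset where `χ^u`,
respectively `χ^(-u)`, does not vanish. -/
def Glued (σ : k →+* k) (Δ : PFan n) (p q : Δ.Charts σ) : Prop :=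
  ∃ (u : Fin n → ℤ[X]) (h : IsGluing p.1.1 q.1.1 u) (r : PSpec σ (adjoin p.1.1 (-u))),
    p.2.1 = r.1.comap (incl k (le_adjoin _ _)) ∧
    q.2.1 = r.1.comap (incl k h.le_adjoin)

/-- The toric `P[σ]`-variety `X_Σ`, with the quotient topology. -/
def Variety (σ : k →+* k) (Δ : PFan n) := Quot (Δ.Glued σ)

instance (σ : k →+* k) (Δ : PFan n) : TopologicalSpace (Δ.Variety σ) :=
  inferInstanceAs (TopologicalSpace (Quot (Δ.Glued σ)))

/-- The prime divisor `D_L` of `X_Σ`, glued from the subvarieties `D(F)` for `F` in `L`. -/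
def divisorLocus (σ : k →+* k) (Δ : PFan n) (L : Δ.PrimeDivisor) : Set (Δ.Variety σ) :=
  {y | ∃ A : Δ.Facet, Quot.mk _ A = L ∧
    ∃ p ∈ faceLocus σ A.1.1 A.2.1, y = Quot.mk _ ⟨A.1, p⟩}

/-! ### Divisors and the Picard module -/

/-- The module of Weil divisors, free on the prime divisors, of which there are only finitely
many: the function `a` stands for `∑ a_L D_L`. -/
abbrev Div (Δ : PFan n) := Δ.PrimeDivisor → ℤ[X]

/-- The map `u ↦ div(χ^u) = ∑ φ_L(u) D_L`. -/
def divChar (Δ : PFan n) : Δ.lattice →ₗ[ℤ[X]] Δ.Div := LinearMap.pi Δ.normal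

/-- The module of characteristic divisors. -/
def charDiv (Δ : PFan n) : Submodule ℤ[X] Δ.Div := LinearMap.range Δ.divChar

open Classical in
/-- The restriction of a divisor to an open set `U`: the terms with `D_L ∩ U` nonempty. -/
def restrict (σ : k →+* k) (Δ : PFan n) (U : Set (Δ.Variety σ)) : Δ.Div →ₗ[ℤ[X]] Δ.Div where
  toFun D L := if (Δ.divisorLocus σ L ∩ U).Nonempty then D L else 0
  map_add' D E := by ext1 L; by_cases h : (Δ.divisorLocus σ L ∩ U).Nonempty <;> simp [h]
  map_smul' g D := by ext1 L; by_cases h : (Δ.divisorLocus σ L ∩ U).Nonempty <;> simp [h]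

/-- `D` is Cartier: `X_Σ` has an open cover on each member of which `D` is characteristic. -/
def IsCartier (σ : k →+* k) (Δ : PFan n) (D : Δ.Div) : Prop :=
  ∃ 𝒰 : Set (Opens (Δ.Variety σ)), (∀ y, ∃ U ∈ 𝒰, y ∈ U) ∧
    ∀ U ∈ 𝒰, ∃ u : Δ.lattice, Δ.restrict σ U D = Δ.restrict σ U (Δ.divChar u)

theorem restrict_eq_of_le {σ : k →+* k} {Δ : PFan n} {U V : Set (Δ.Variety σ)} (h : V ⊆ U)
    {D E : Δ.Div} (hDE : Δ.restrict σ U D = Δ.restrict σ U E) :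
    Δ.restrict σ V D = Δ.restrict σ V E := by
  classical
  ext1 L
  have hL := congrFun hDE L
  simp only [restrict, LinearMap.coe_mk, AddHom.coe_mk] at hL ⊢
  by_cases hV : (Δ.divisorLocus σ L ∩ V).Nonempty
  · rw [if_pos (hV.mono (Set.inter_subset_inter_right _ h)),
      if_pos (hV.mono (Set.inter_subset_inter_right _ h))] at hL
    rw [if_pos hV, if_pos hV, hL]
  · rw [if_neg hV, if_neg hV]

/-- The module of Cartier divisors. -/
def cartierDiv (σ : k →+* k) (Δ : PFan n) : Submodule ℤ[X] Δ.Div where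
  carrier := {D | Δ.IsCartier σ D}
  zero_mem' := ⟨Set.univ, fun _ => ⟨⊤, trivial, trivial⟩, fun _ _ => ⟨0, by simp⟩⟩
  add_mem' := by
    rintro D E ⟨𝒰, h𝒰, hD⟩ ⟨𝒱, h𝒱, hE⟩
    refine ⟨{W | ∃ U ∈ 𝒰, ∃ V ∈ 𝒱, W = U ⊓ V}, fun y => ?_, ?_⟩
    · obtain ⟨U, hU, hyU⟩ := h𝒰 y
      obtain ⟨V, hV, hyV⟩ := h𝒱 y
      exact ⟨U ⊓ V, ⟨U, hU, V, hV, rfl⟩, ⟨hyU, hyV⟩⟩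
    · rintro _ ⟨U, hU, V, hV, rfl⟩
      obtain ⟨u, hu⟩ := hD U hU
      obtain ⟨v, hv⟩ := hE V hV
      refine ⟨u + v, ?_⟩
      rw [map_add, map_add, map_add, restrict_eq_of_le (V := ((U ⊓ V : Opens _) : Set _)) (fun _ h => h.1) hu,
        restrict_eq_of_le (V := ((U ⊓ V : Opens _) : Set _)) (fun _ h => h.2) hv]
  smul_mem' := by
    rintro g D ⟨𝒰, h𝒰, hD⟩
    refine ⟨𝒰, h𝒰, fun U hU => ?_⟩
    obtain ⟨u, hu⟩ := hD U hU
    exact ⟨g • u, by rw [map_smul, map_smul, map_smul, hu]⟩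

/-- The Picard module: Cartier divisors modulo characteristic divisors (all of which are
Cartier). -/
abbrev Pic (σ : k →+* k) (Δ : PFan n) :=
  Δ.cartierDiv σ ⧸ Δ.charDiv.comap (Δ.cartierDiv σ).subtype

theorem charDiv_le_cartierDiv (σ : k →+* k) (Δ : PFan n) : Δ.charDiv ≤ Δ.cartierDiv σ := by
  rintro _ ⟨u, rfl⟩
  exact ⟨Set.univ, fun _ => ⟨⊤, trivial, trivial⟩, fun _ _ => ⟨u, rfl⟩⟩

end Variety

end PFan

/-- A `ℤ[x]`-lattice: a `ℤ[x]`-module that embeds into `ℤ[x]^m` for some `m`. -/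
def IsZxLattice (A : Type*) [AddCommGroup A] [Module ℤ[X] A] : Prop :=
  ∃ (m : ℕ) (f : A →ₗ[ℤ[X]] (Fin m → ℤ[X])), Function.Injective f

end

/-! ### Facets, normal vectors and compactness -/

namespace PToric

variable {n : ℕ}

/-! Everything comes from one compact `S` in the fan, and compactness is used twice.

It gives a point common to all the divisors of `S`. Two elements of `S` with sum `0` lie in every
facet, hence vanish, so `S` has no nonzero invertible elements. Taking the constant term is then a
ring homomorphism from `k[S]` to `k`, and its kernel is a point of the chart of `S` lying on `D(F)`
for every facet `F` (`isPPrime_ker_constTerm`, `ker_constTerm_mem_faceLocus`). A Cartier divisor is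
characteristic on a neighbourhood of this point, so a single `div(χ^u)` has the same coefficients as
the divisor along all the facets of `S` (`coneCoeffs_mem_range`).

It also makes this `u` unique. If every `φ_L` with `L` coming from a facet of `S` kills `w`, then
`w` has a nonzero multiple in each `F^md`; a common multiple lies in their intersection, which is
zero (`coneCoeffs_divChar_injective`).

Hence `u` depends linearly on the Cartier divisor `D`, and `D ↦ D - div(χ^u)` is linear with kernel
exactly the characteristic divisors. So the Picard module embeds into the module of Weil divisors,
which is free of finite rank. -/

theorem P.smul_eq_zero {g : P} {u : Fin n → ℤ[X]} (hg : g ≠ 0) (h : g • u = 0) : u = 0 :=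
  (_root_.smul_eq_zero.mp (show (g : ℤ[X]) • u = 0 from h)).resolve_left
    fun h0 => hg (Subtype.ext h0)

/-- The kernel of the standard normal vector of `F` is the saturation of `F^md`. -/
theorem IsStandardNormal.exists_smul_mem_md {S F : Semimod n} {φ : Module.Dual ℤ[X] (md S)}
    (hφ : IsStandardNormal S F φ) (hF : IsFacet S F) {u : md S} (hu : φ u = 0) :
    ∃ a : ℤ[X], a ≠ 0 ∧ a • (u : Fin n → ℤ[X]) ∈ md F := by
  have hN : Module.finrank ℤ[X] ((md F).comap (md S).subtype) + 1 =
      Module.finrank ℤ[X] (md S) := by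
    rw [(Submodule.comapSubtypeEquivOfLe (md_mono hF.isFace.le)).finrank_eq]
    exact hF.rank_add_one
  -- If `φ` were zero, `F` would be all of `S`, against the drop in rank.
  have h0 : φ ≠ 0 := by
    rintro rfl
    have hSF : S ≤ F := fun u hu => (hφ.mem ⟨u, mem_md_of_mem hu⟩).mpr ⟨rfl, hu⟩
    have := hF.rank_add_one
    rw [le_antisymm hSF hF.isFace.le] at this
    omega
  have hker : ∀ v ∈ (md F).comap (md S).subtype, φ v = 0 := by
    rintro ⟨_, hv⟩ ⟨a, ha, b, hb, rfl⟩
    have h1 := ((hφ.mem ⟨a, mem_md_of_mem (hF.isFace.le ha)⟩).mp ha).1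
    have h2 := ((hφ.mem ⟨b, mem_md_of_mem (hF.isFace.le hb)⟩).mp hb).1
    have : (⟨a - b, hv⟩ : md S) = ⟨a, mem_md_of_mem (hF.isFace.le ha)⟩ -
      ⟨b, mem_md_of_mem (hF.isFace.le hb)⟩ := rfl
    exact this ▸ (by rw [map_sub, h1, h2, sub_zero])
  -- The kernel of the nonzero form `φ` contains `F^md` and has the same rank, so it is torsion
  -- modulo `F^md`.
  exact exists_smul_mem_of_finrank hN h0 hker hu

theorem isStandardNormal_standardNormal {S F : Semimod n} (hF : IsFacet S F) :
    IsStandardNormal S F (standardNormal hF) :=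
  (existsUnique_isStandardNormal hF).choose_spec.1

/-- In a compact semimodule, an element which has a nonzero multiple in `F^md` for every facet `F`
is zero. -/
theorem IsCompactSemimod.eq_zero {S : Semimod n} (hS : IsCompactSemimod S) (hfg : S.FG)
    {w : Fin n → ℤ[X]} (hw : w ∈ md S)
    (h : ∀ F, IsFacet S F → ∃ a : ℤ[X], a ≠ 0 ∧ a • w ∈ md F) : w = 0 := by
  classical
  have hfin : {F | IsFacet S F}.Finite :=
    (finite_setOf_isFace hfg).subset fun _ h => h.isFace
  choose! a ha0 ha using h
  -- There are finitely many facets, so the product of the multipliers `a F` serves all of them at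
  -- once.
  have h0 : ∏ F ∈ hfin.toFinset, a F ≠ 0 :=
    Finset.prod_ne_zero_iff.mpr fun F hF => ha0 F (hfin.mem_toFinset.mp hF)
  have hmem : (∏ F ∈ hfin.toFinset, a F) • w ∈
      md S ⊓ ⨅ F ∈ {F : Semimod n | IsFacet S F}, md F := by
    refine ⟨(md S).smul_mem _ hw, ?_⟩
    refine Submodule.mem_iInf _ |>.mpr fun F => Submodule.mem_iInf _ |>.mpr fun hF => ?_
    rw [← Finset.prod_erase_mul _ _ (hfin.mem_toFinset.mpr hF), mul_smul]
    exact (md F).smul_mem _ (ha F hF)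
  rw [hS, Submodule.mem_bot] at hmem
  exact (_root_.smul_eq_zero.mp hmem).resolve_left h0

/-- Compact semimodules have no nonzero invertible elements. -/
theorem IsCompactSemimod.eq_zero_of_add_eq_zero {S : Semimod n} (hS : IsCompactSemimod S)
    {u v : Fin n → ℤ[X]} (hu : u ∈ S) (hv : v ∈ S) (huv : u + v = 0) : u = 0 := by
  have hmem : u ∈ md S ⊓ ⨅ F ∈ {F : Semimod n | IsFacet S F}, md F := by
    refine ⟨mem_md_of_mem hu, ?_⟩
    refine Submodule.mem_iInf _ |>.mpr fun F => Submodule.mem_iInf _ |>.mpr fun hF => ?_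
    -- A face contains `0 = u + v`, hence both summands.
    exact mem_md_of_mem (hF.isFace.of_add_mem u hu v hv (huv ▸ F.zero_mem)).1
  rwa [hS, Submodule.mem_bot] at hmem

/-! ### The distinguished point of a semimodule without invertible elements -/

section Augmentation

variable {k : Type*} [Field k]

open Classical in
/-- The constant term `k[S] → k` for a semimodule `S` without nonzero invertible elements. -/
noncomputable def constTerm (k : Type*) [Field k] {S : Semimod n}
    (hS : ∀ u ∈ S, ∀ v ∈ S, u + v = 0 → u = 0) : Alg k S →+* k :=
  (AddMonoidAlgebra.lift k k S
    { toFun := fun u => if u.toAdd = 0 then 1 else 0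
      map_one' := by simp
      map_mul' := fun u v => by
        -- Multiplicativity amounts to this: a sum of exponents vanishes only if both do, which is
        -- the absence of invertible elements.
        have key : u.toAdd + v.toAdd = 0 ↔ u.toAdd = 0 ∧ v.toAdd = 0 := by
          refine ⟨fun h => ?_, fun h => by rw [h.1, h.2, add_zero]⟩
          have h' : (u.toAdd : Fin n → ℤ[X]) + v.toAdd = 0 := congrArg Subtype.val h
          exact ⟨Subtype.ext (hS _ u.toAdd.2 _ v.toAdd.2 h'),
            Subtype.ext (hS _ v.toAdd.2 _ u.toAdd.2 (by rw [add_comm, h']))⟩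
        rw [toAdd_mul]
        simp only [key, ite_and, ite_mul, one_mul, zero_mul] } : Alg k S →ₐ[k] k).toRingHom

variable {S : Semimod n} (hS : ∀ u ∈ S, ∀ v ∈ S, u + v = 0 → u = 0)

open Classical in
theorem constTerm_single (u : S) (c : k) :
    constTerm k hS (AddMonoidAlgebra.single u c) = if u = 0 then c else 0 := by
  simp [constTerm]

/-- Multiplication by `x` keeps nonzero exponents nonzero, so no new term reaches exponent `0`, and
on the constant term `shift` acts as `σ`. -/
theorem constTerm_shift (σ : k →+* k) (f : Alg k S) :
    constTerm k hS (shift σ S f) = σ (constTerm k hS f) := by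
  classical
  suffices (constTerm k hS).comp (shift σ S) = σ.comp (constTerm k hS) from
    RingHom.congr_fun this f
  have hx : ∀ u : S, xP • u = 0 ↔ u = 0 := fun u =>
    ⟨fun h => Subtype.ext (P.smul_eq_zero
      (fun h0 => X_ne_zero (congrArg Subtype.val h0)) (congrArg Subtype.val h)),
      fun h => by rw [h, smul_zero]⟩
  refine AddMonoidAlgebra.ringHom_ext (fun c => ?_) (fun u => ?_)
  · simp [shift_single, constTerm_single]
  · simp only [RingHom.comp_apply, shift_single, constTerm_single, hx]
    split_ifs <;> simp

theorem constTerm_iterate_shift (σ : k →+* k) (f : Alg k S) (i : ℕ) :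
    constTerm k hS ((shift σ S)^[i] f) = σ^[i] (constTerm k hS f) := by
  induction i with
  | zero => rfl
  | succ i ih => rw [Function.iterate_succ_apply', Function.iterate_succ_apply',
      constTerm_shift, ih]

/-- The ideal spanned by the `χ^u`, `u ≠ 0`, is `P[σ]`-prime. -/
theorem isPPrime_ker_constTerm (σ : k →+* k) : IsPPrime σ (RingHom.ker (constTerm k hS)) where
  isPrime := RingHom.ker_isPrime _
  shift_mem f hf := by
    rw [RingHom.mem_ker] at hf ⊢
    rw [constTerm_shift, hf, map_zero]
  perfect f g _ hfg := by
    rw [RingHom.mem_ker, spow, map_prod] at hfg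
    obtain ⟨i, _, hi⟩ := Finset.prod_eq_zero_iff.mp hfg
    rw [map_pow, constTerm_iterate_shift] at hi
    -- The quotient is the field `k`, on which iterates of `σ` are injective: a vanishing factor
    -- forces the constant term itself to vanish.
    exact (σ.injective.iterate i) ((eq_zero_of_pow_eq_zero hi).trans (iterate_map_zero σ i).symm)
  chi_smul_mul_mem u f g hg h := by
    classical
    -- For `u = 0` the exponent does not change; otherwise `g • u ≠ 0` and `χ^(g u)` alone already
    -- lies in the ideal.
    by_cases hu : u = 0
    · rw [hu, smul_zero]
      exact hu ▸ h
    · have hgu : g • u ≠ 0 := fun h =>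
        hu (Subtype.ext (P.smul_eq_zero hg (congrArg Subtype.val h)))
      rw [RingHom.mem_ker, map_mul, chi, constTerm_single, if_neg hgu, zero_mul]

/-- Since `0` lies in `F`, exponents outside `F` are nonzero, so their `χ^u` have no constant term.
The point does not depend on `F`: all the subvarieties `D(F)` of the chart meet there. -/
theorem ker_constTerm_mem_faceLocus (σ : k →+* k) (F : Semimod n) :
    (⟨_, isPPrime_ker_constTerm hS σ⟩ : PSpec σ S) ∈ faceLocus σ S F := by
  classical
  rintro _ ⟨u, hu, rfl⟩
  have hu0 : u ≠ 0 := fun h => hu (h ▸ F.zero_mem)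
  change chi k u ∈ RingHom.ker (constTerm k hS)
  rw [RingHom.mem_ker, chi, constTerm_single, if_neg hu0]

end Augmentation

end PToric

/-! ### Divisors along the facets of one semimodule -/

namespace PFan

open PToric

variable {n : ℕ} {Δ : PFan n}

/-- Equivalent facets both have the lattice of the common face `H`, so `F^md` descends to the
quotient, also along chains of equivalences. -/
theorem md_eq_of_mk_eq {A B : Δ.Facet}
    (h : (Quot.mk _ A : Δ.PrimeDivisor) = Quot.mk _ B) : md A.2.1 = md B.2.1 := by
  let f : Δ.PrimeDivisor → Submodule ℤ[X] (Fin n → ℤ[X]) :=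
    Quot.lift (fun A => md A.2.1) fun _ _ ⟨_, _, _, _, h1, h2⟩ => h1.trans h2.symm
  exact congrArg f h

theorem exists_smul_mem_md_of_facetNormal {A : Δ.Facet} {w : Δ.lattice}
    (hw : Δ.facetNormal A w = 0) :
    ∃ a : ℤ[X], a ≠ 0 ∧ a • (w : Fin n → ℤ[X]) ∈ md A.2.1 :=
  (isStandardNormal_standardNormal A.2.2).exists_smul_mem_md A.2.2
    (u := Submodule.inclusion (Δ.md_eq _ A.1.2).ge w) hw

/-- Whether or not `φ_L` is computed from the given facet in `L`, its kernel is the saturation of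
the lattice of that facet. -/
theorem exists_smul_mem_md_of_normal {A : Δ.Facet} {w : Δ.lattice}
    (hw : Δ.normal (Quot.mk _ A) w = 0) :
    ∃ a : ℤ[X], a ≠ 0 ∧ a • (w : Fin n → ℤ[X]) ∈ md A.2.1 := by
  -- The representative defining `φ_L` may be a facet of another semimodule of the fan; only its
  -- lattice matters here, and that is the same.
  rw [← md_eq_of_mk_eq (Quot.out_eq (Quot.mk Δ.FacetEquiv A))]
  exact exists_smul_mem_md_of_facetNormal hw

/-- The part of a divisor supported on the prime divisors that come from facets of `S`. -/
noncomputable def coneCoeffs (Δ : PFan n) (S : {S // S ∈ Δ.cones}) :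
    Δ.Div →ₗ[ℤ[X]] ({F : Semimod n // IsFacet S.1 F} → ℤ[X]) :=
  LinearMap.funLeft ℤ[X] ℤ[X] fun F => Quot.mk _ ⟨S, F⟩

/-- This is the uniqueness of the local equation: compactness leaves no room for a nonzero `w`
killed by the normals of all facets of `S`. -/
theorem coneCoeffs_divChar_injective {S : {S // S ∈ Δ.cones}} (hS : IsCompactSemimod S.1) :
    Function.Injective (Δ.coneCoeffs S ∘ₗ Δ.divChar) := by
  rw [injective_iff_map_eq_zero]
  intro w hw
  refine Subtype.ext (hS.eq_zero (Δ.fg _ S.2) (by rw [Δ.md_eq _ S.2]; exact w.2) fun F hF => ?_)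
  exact exists_smul_mem_md_of_normal (A := ⟨S, F, hF⟩) (congrFun hw ⟨F, hF⟩)

/-! ### Cartier divisors and the embedding of the Picard module -/

variable {k : Type*} [Field k]

/-- All the prime divisors coming from facets of a compact `S` pass through one point, so a Cartier
divisor is characteristic along all of them at once. -/
theorem coneCoeffs_mem_range {σ : k →+* k} {S : {S // S ∈ Δ.cones}} (hS : IsCompactSemimod S.1)
    {D : Δ.Div} (hD : Δ.IsCartier σ D) :
    Δ.coneCoeffs S D ∈ LinearMap.range (Δ.coneCoeffs S ∘ₗ Δ.divChar) := by
  classical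
  have hpt : ∀ u ∈ S.1, ∀ v ∈ S.1, u + v = 0 → u = 0 := fun u hu v hv =>
    hS.eq_zero_of_add_eq_zero hu hv
  obtain ⟨𝒰, hcov, h𝒰⟩ := hD
  obtain ⟨U, hU, hyU⟩ := hcov (Quot.mk _ ⟨S, _, isPPrime_ker_constTerm hpt σ⟩)
  obtain ⟨u, hu⟩ := h𝒰 U hU
  refine ⟨u, funext fun F => ?_⟩
  -- The distinguished point lies on this divisor and in `U`, so restriction to `U` keeps the
  -- coefficient.
  have hne : (Δ.divisorLocus σ (Quot.mk _ ⟨S, F⟩) ∩ U).Nonempty :=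
    ⟨_, ⟨⟨S, F⟩, rfl, _, ker_constTerm_mem_faceLocus hpt σ F.1, rfl⟩, hyU⟩
  have h := congrFun hu (Quot.mk _ ⟨S, F⟩)
  simp only [restrict, LinearMap.coe_mk, AddHom.coe_mk, if_pos hne] at h
  exact h.symm

/-- If `Σ` contains a compact semimodule, the Picard module embeds into the module of Weil
divisors. -/
theorem exists_pic_injective (σ : k →+* k) {S : {S // S ∈ Δ.cones}}
    (hS : IsCompactSemimod S.1) :
    ∃ f : Δ.Pic σ →ₗ[ℤ[X]] Δ.Div, Function.Injective f := by
  let e := LinearEquiv.ofInjective _ (coneCoeffs_divChar_injective hS)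
  -- `v D` is the unique `u` for which `D` and `div(χ^u)` agree along the facets of `S`; linearity
  -- comes from inverting an injective linear map on its range.
  let v : Δ.cartierDiv σ →ₗ[ℤ[X]] Δ.lattice := e.symm.toLinearMap ∘ₗ
    (Δ.coneCoeffs S ∘ₗ (Δ.cartierDiv σ).subtype).codRestrict _
      fun D => coneCoeffs_mem_range (σ := σ) hS (show Δ.IsCartier σ D.1 from D.2)
  have hv : ∀ (D : Δ.cartierDiv σ) (u : Δ.lattice), D.1 = Δ.divChar u → v D = u := by
    intro D u h
    refine e.symm_apply_eq.mpr (Subtype.ext ?_)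
    exact congrArg (Δ.coneCoeffs S) h
  -- Normalise `D` to have zero coefficients along the facets of `S`; every class in the Picard
  -- module has exactly one such representative.
  let f : Δ.cartierDiv σ →ₗ[ℤ[X]] Δ.Div := (Δ.cartierDiv σ).subtype - Δ.divChar ∘ₗ v
  have hker : LinearMap.ker f = Δ.charDiv.comap (Δ.cartierDiv σ).subtype := by
    ext D
    rw [LinearMap.mem_ker, Submodule.mem_comap]
    constructor
    · exact fun h => ⟨v D, (sub_eq_zero.mp h).symm⟩
    · rintro ⟨u, hu⟩
      have := hv D u hu.symm
      exact sub_eq_zero.mpr (hu.symm.trans (congrArg Δ.divChar this.symm))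
  refine ⟨Submodule.liftQ _ f hker.ge, ?_⟩
  rw [← LinearMap.ker_eq_bot]
  exact Submodule.ker_liftQ_eq_bot _ _ _ hker.le

end PFan

theorem mainTheorem11 (k : Type*) [Field k] [CharZero k] (σ : k →+* k) (n : ℕ) (Δ : PFan n)
    (hΔ : ∃ S ∈ Δ.cones, PToric.IsCompactSemimod S) :
    Module.IsTorsionFree ℤ[X] (Δ.Pic σ) ∧ IsZxLattice (Δ.Pic σ) := by
  obtain ⟨S, hSΔ, hS⟩ := hΔ
  obtain ⟨f, hf⟩ := PFan.exists_pic_injective σ (S := ⟨S, hSΔ⟩) hS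
  -- Torsion-freeness pulls back along the embedding into Weil divisors; numbering the finitely many
  -- prime divisors then identifies the target with some `ℤ[x]^m`.
  refine ⟨hf.moduleIsTorsionFree f fun a x => map_smul f a x, ?_⟩
  let e := Finite.equivFin Δ.PrimeDivisor
  exact ⟨_, (LinearEquiv.funCongrLeft ℤ[X] ℤ[X] e.symm).toLinearMap ∘ₗ f,
    (LinearEquiv.funCongrLeft ℤ[X] ℤ[X] e.symm).injective.comp hf⟩
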